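/- Let $Q_n$ be the $n$-dimensional hypercube, i.e. the graph whose vertices are the binary sequences of length $n$, two of them being adjacent if and only if they differ in exactly one position. A vertex is called even (odd) if it has an even (odd) number of $1$'s. A fault in $Q_n$ is a set $F$ of vertices of $Q_n$; its mass is $|F|$, it is neutral if it contains equally many even and odd vertices, and $Q_n-F$ denotes the subgraph of $Q_n$ induced on the vertices outside $F$. For an even integer $M\ge 0$ let $[M]$ be the smallest positive integer $m$ such that, for every $n\ge m$ and every neutral fault $F$ of mass $M$ in $Q_n$, the graph $Q_n-F$ has a Hamiltonian cycle. Then for every $n\ge 4$ and every neutral fault $F$ of mass $4$ in $Q_n$ (that is, two even and two odd deleted vertices), the graph $Q_n-F$ has a Hamiltonian cycle. The claim fails for $n=3$: there is a neutral fault $F$ of mass $4$ in $Q_3$ such that $Q_3-F$ has no Hamiltonian cycle. Consequently $[4]=4$. -/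

import Mathlib

namespace FaultyCube

/-- The vertices of the `n`-dimensional binary hypercube: binary sequences of length `n`. -/
abbrev Vertex (n : ℕ) : Type := Fin n → Bool

/-- The hypercube `Q_n`: two binary sequences are adjacent if and only if they differ in exactly
one position. -/
def Q (n : ℕ) : SimpleGraph (Vertex n) where
  Adj x y := hammingDist x y = 1
  symm := ⟨fun x y h => by rw [hammingDist_comm]; exact h⟩
  loopless := ⟨fun x h => by simp at h⟩

/-- A vertex is even if it has an even number of `1`s, and odd otherwise. Even vertices play the
role of the red ones, odd vertices that of the green ones. -/
def IsEven {n : ℕ} (x : Vertex n) : Prop :=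
  Even (Finset.univ.filter fun i => x i = true).card

instance {n : ℕ} : DecidablePred (IsEven (n := n)) := fun x =>
  inferInstanceAs (Decidable (Even (Finset.univ.filter fun i => x i = true).card))

/-- A fault in `Q_n` is a set of deleted vertices. -/
abbrev Fault (n : ℕ) : Type := Finset (Vertex n)

/-- The mass of a fault: the number of deleted vertices. -/
def mass {n : ℕ} (F : Fault n) : ℕ := F.card

/-- The charge of a fault: the absolute value of the difference between the numbers of its
vertices of the two parities. -/
def charge {n : ℕ} (F : Fault n) : ℕ :=
  (((F.filter fun x => IsEven x).card : ℤ) - ((F.filter fun x => ¬ IsEven x).card : ℤ)).natAbs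

/-- A fault is neutral if its charge is zero. -/
def IsNeutral {n : ℕ} (F : Fault n) : Prop := charge F = 0

/-- `Q_n - F`: the subgraph of `Q_n` induced on the vertices that are not deleted. -/
def Qminus (n : ℕ) (F : Fault n) : SimpleGraph {x : Vertex n // x ∉ F} :=
  (Q n).induce {x | x ∉ F}

/-- `Q_n - F` is Hamiltonian for every neutral fault `F` of mass `M` in `Q_n`. -/
def HamiltonianForNeutral (M n : ℕ) : Prop :=
  ∀ F : Fault n, IsNeutral F → mass F = M → (Qminus n F).IsHamiltonian

/-- The set `A_M` of positive integers `m` such that, for every `n ≥ m`, the graph `Q_n - F` is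
Hamiltonian for every neutral fault `F` of mass `M` in `Q_n`. Its least element is `[M]`. -/
def A (M : ℕ) : Set ℕ := {m | 0 < m ∧ ∀ n, m ≤ n → HamiltonianForNeutral M n}

end FaultyCube

/-!
Splitting `Q (n + 1)` along a coordinate gives two faces, each a copy of `Q n`, in which
corresponding vertices are adjacent. Hamiltonian paths of the two faces, avoiding the deleted
vertices and having the same ends, close up to a Hamiltonian cycle; and paths of the two faces with
one common end combine to a path, so that the paths needed can be built by induction.

Let `r₁`, `r₂` be the deleted vertices of one parity and `g₁`, `g₂` those of the other. If some
coordinate separates the `r`s but not the `g`s, one of its faces contains three deleted vertices and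
the other one. The ends of the path in the first face must have the parity that occurs once among
the vertices deleted there. Such ends exist, and the corresponding vertices of the other face have
the parity opposite to that of its deleted vertex, which is all that a path between them requires.
Otherwise every coordinate that separates the `r`s separates the `g`s as well. Each face of such a
coordinate `i` contains one `r` and one `g`, and since `r₁` and `r₂` agree in parity they differ in
a second coordinate `j`, which separates the `g`s too. Splitting both faces along `j`, suitable ends
can be chosen in common.

In `Q 3` the four deleted vertices can leave just two disjoint edges.
-/

namespace FaultyCube

section HamJoined

variable {V W : Type*} {G : SimpleGraph V} {H : SimpleGraph W} {S T : Set V} {a b c d : V}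

/-- `a` and `b` are joined by a path of `G` whose vertices are exactly those of `S`, that is, by a
Hamiltonian path of the subgraph induced on `S`. -/
def HamJoined (G : SimpleGraph V) (S : Set V) (a b : V) : Prop :=
  ∃ p : G.Walk a b, p.IsPath ∧ ∀ x, x ∈ p.support ↔ x ∈ S

theorem HamJoined.singleton (a : V) : HamJoined G {a} a a :=
  ⟨.nil, .nil, by simp⟩

theorem HamJoined.univ_of_subsingleton [Subsingleton V] (a b : V) :
    HamJoined G Set.univ a b := by
  rw [Subsingleton.elim b a, ← Subsingleton.eq_univ_of_nonempty (Set.singleton_nonempty a)]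
  exact .singleton a

theorem HamJoined.right_mem (h : HamJoined G S a b) : b ∈ S := by
  obtain ⟨p, -, hpS⟩ := h
  exact (hpS b).1 p.end_mem_support

theorem HamJoined.symm (h : HamJoined G S a b) : HamJoined G S b a := by
  obtain ⟨p, hp, hpS⟩ := h
  exact ⟨p.reverse, hp.reverse, by simpa using hpS⟩

theorem HamJoined.append (h : HamJoined G S a b) (hbc : G.Adj b c) (h' : HamJoined G T c d)
    (hST : Disjoint S T) : HamJoined G (S ∪ T) a d := by
  obtain ⟨p, hp, hpS⟩ := h
  obtain ⟨q, hq, hqT⟩ := h'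
  refine ⟨p.append (.cons hbc q), ?_, by simp [SimpleGraph.Walk.support_append, hpS, hqT]⟩
  rw [SimpleGraph.Walk.isPath_def, SimpleGraph.Walk.support_append,
    SimpleGraph.Walk.support_cons, List.tail_cons, List.nodup_append']
  exact ⟨hp.support_nodup, hq.support_nodup, fun x hx hx' =>
    hST.notMem_of_mem_left ((hpS x).1 hx) ((hqT x).1 hx')⟩

theorem HamJoined.map (h : HamJoined G S a b) (f : G →g H) (hf : Function.Injective f) :
    HamJoined H (f '' S) (f a) (f b) := by
  obtain ⟨p, hp, hpS⟩ := h
  exact ⟨p.map f, hp.map hf, by simp [hpS]⟩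

theorem HamJoined.isHamiltonian_induce [DecidableEq V] [Fintype S] (h : HamJoined G S a b)
    (hba : G.Adj b a) (hc : c ∈ S) (hca : c ≠ a) (hcb : c ≠ b) : (G.induce S).IsHamiltonian := by
  intro _
  obtain ⟨p, hp, hpS⟩ := h
  let q := p.induce S fun x => (hpS x).1
  have hq : q.IsPath := by
    apply SimpleGraph.Walk.IsPath.of_map (f := (SimpleGraph.Embedding.induce S).toHom)
    rwa [SimpleGraph.Walk.map_induce]
  have hqS : ∀ x, x ∈ q.support := fun x => by simp [q, hpS]
  have haS : a ∈ S := (hpS a).1 p.start_mem_support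
  have hbS : b ∈ S := (hpS b).1 p.end_mem_support
  have hba' : (G.induce S).Adj ⟨b, hbS⟩ ⟨a, haS⟩ := hba
  refine ⟨_, .cons hba' q, (SimpleGraph.Walk.cons_isCycle_iff ..).2 ⟨hq, fun he => ?_⟩,
    by simpa [SimpleGraph.Walk.IsHamiltonian] using hq.isHamiltonian_of_mem hqS⟩
  rw [Sym2.eq_swap] at he
  have hcq := hqS ⟨c, hc⟩
  rw [hq.eq_adj_toWalk_of_mem_edges he] at hcq
  simp [hca, hcb] at hcq

end HamJoined

section Face

variable {n : ℕ} {i : Fin (n + 1)} {v w : Bool} {x y : Vertex n}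

/-- The parity of the number of `1`s of a vertex: `true` for the odd vertices. As a Boolean it
changes by `xor` when a coordinate is inserted. -/
def parity (x : Vertex n) : Bool := decide (¬ IsEven x)

/-- The vertex `x` of `Q n`, viewed in the face of `Q (n + 1)` on which the `i`-th coordinate
is `v`. -/
def face (i : Fin (n + 1)) (v : Bool) (x : Vertex n) : Vertex (n + 1) :=
  i.insertNth (α := fun _ => Bool) v x

@[simp]
theorem face_apply_self (i : Fin (n + 1)) (v : Bool) (x : Vertex n) : face i v x i = v :=
  Fin.insertNth_apply_same (α := fun _ => Bool) i v x

@[simp]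
theorem face_apply_succAbove (i : Fin (n + 1)) (v : Bool) (x : Vertex n) (j : Fin n) :
    face i v x (i.succAbove j) = x j :=
  Fin.insertNth_apply_succAbove (α := fun _ => Bool) i v x j

@[simp]
theorem face_inj : face i v x = face i w y ↔ v = w ∧ x = y :=
  Fin.insertNth_inj (α := fun _ => Bool)

theorem exists_face_eq (i : Fin (n + 1)) (x : Vertex (n + 1)) : ∃ v y, face i v y = x :=
  ⟨x i, i.removeNth x, Fin.insertNth_self_removeNth (α := fun _ => Bool) i x⟩

theorem exists_face_eq_of_ne {x y : Vertex (n + 1)} (h : x ≠ y) :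
    ∃ i v w x' y', v ≠ w ∧ face i v x' = x ∧ face i w y' = y := by
  obtain ⟨i, hi⟩ := Function.ne_iff.1 h
  obtain ⟨v, x', rfl⟩ := exists_face_eq i x
  obtain ⟨w, y', rfl⟩ := exists_face_eq i y
  exact ⟨i, v, w, x', y', by simpa using hi, rfl, rfl⟩

theorem isEven_face : IsEven (face i v x) ↔ (v = true ↔ ¬ IsEven x) := by
  unfold IsEven
  rw [Finset.card_filter, Finset.card_filter, Fin.sum_univ_succAbove _ i]
  simp only [face_apply_self, face_apply_succAbove]
  cases v <;> simp [Nat.even_add_one, add_comm 1]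

theorem parity_face (i : Fin (n + 1)) (v : Bool) (x : Vertex n) :
    parity (face i v x) = (v ^^ parity x) := by
  by_cases h : IsEven x <;> cases v <;> simp [parity, isEven_face, h]

@[simp]
theorem parity_face_eq_iff : parity (face i v x) = parity (face i v y) ↔ parity x = parity y := by
  rw [parity_face, parity_face, Bool.xor_right_inj]

theorem parity_face_eq_iff_of_ne (h : v ≠ w) :
    parity (face i v x) = parity (face i w y) ↔ parity x ≠ parity y := by
  grind [cases Bool, parity_face]

theorem exists_parity_ne (hn : 1 ≤ n) (x : Vertex n) : ∃ y : Vertex n, parity y ≠ parity x := by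
  obtain ⟨n, rfl⟩ := Nat.exists_eq_add_of_le' hn
  obtain ⟨v, x, rfl⟩ := exists_face_eq 0 x
  exact ⟨face 0 (!v) x, by simp [parity_face]⟩

theorem one_le_of_parity_ne (h : parity x ≠ parity y) : 1 ≤ n := by
  refine Nat.one_le_iff_ne_zero.2 ?_
  rintro rfl
  exact h (congrArg parity (Subsingleton.elim x y))

theorem hammingDist_face (i : Fin (n + 1)) (v w : Bool) (x y : Vertex n) :
    hammingDist (face i v x) (face i w y) = (if v ≠ w then 1 else 0) + hammingDist x y := by
  unfold hammingDist
  rw [Finset.card_filter, Finset.card_filter, Fin.sum_univ_succAbove _ i]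
  simp only [face_apply_self, face_apply_succAbove]

theorem adj_face_of_ne (i : Fin (n + 1)) (h : v ≠ w) (x : Vertex n) :
    (Q (n + 1)).Adj (face i v x) (face i w x) := by
  simp [Q, hammingDist_face, h]

/-- `face i v` as a homomorphism of hypercubes. -/
def faceHom (i : Fin (n + 1)) (v : Bool) : Q n →g Q (n + 1) where
  toFun := face i v
  map_rel' h := by simpa [Q, hammingDist_face] using h

theorem faceHom_injective (i : Fin (n + 1)) (v : Bool) : Function.Injective (faceHom i v) :=
  fun _ _ h => (face_inj.1 h).2

theorem HamJoined.join_faces {S T : Set (Vertex n)} {U : Set (Vertex (n + 1))}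
    {a b c : Vertex n} (h : HamJoined (Q n) S a b) (i : Fin (n + 1)) (hvw : v ≠ w)
    (h' : HamJoined (Q n) T b c) (hS : ∀ x, face i v x ∈ U ↔ x ∈ S)
    (hT : ∀ x, face i w x ∈ U ↔ x ∈ T) : HamJoined (Q (n + 1)) U (face i v a) (face i w c) := by
  have hU : faceHom i v '' S ∪ faceHom i w '' T = U := by
    ext x
    obtain ⟨u, x, rfl⟩ := exists_face_eq i x
    obtain rfl | rfl : u = v ∨ u = w := by grind [cases Bool]
    all_goals simp [faceHom, hS, hT, hvw, hvw.symm]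
  rw [← hU]
  refine (h.map _ (faceHom_injective i v)).append (adj_face_of_ne i hvw b)
    (h'.map _ (faceHom_injective i w)) ?_
  rw [Set.disjoint_left]
  rintro _ ⟨x, -, rfl⟩ ⟨y, -, hyx⟩
  exact hvw (face_inj.1 hyx).1.symm

theorem HamJoined.qminus_isHamiltonian {S T : Set (Vertex n)} {F : Fault (n + 1)}
    {a b : Vertex n} (hab : a ≠ b) (h : HamJoined (Q n) S a b) (h' : HamJoined (Q n) T a b)
    (i : Fin (n + 1)) (hvw : v ≠ w) (hS : ∀ x, face i v x ∉ F ↔ x ∈ S)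
    (hT : ∀ x, face i w x ∉ F ↔ x ∈ T) : (Qminus (n + 1) F).IsHamiltonian :=
  (h.join_faces (U := {x | x ∉ F}) i hvw h'.symm hS hT).isHamiltonian_induce
    (adj_face_of_ne i hvw.symm a) ((hS b).2 h.right_mem) (by simpa using hab.symm)
    (by simp [hvw])

end Face

section HamiltonianPaths

variable {n : ℕ} {i : Fin (n + 1)} {v w : Bool}

theorem hamJoined_univ {a b : Vertex n} (hab : parity a ≠ parity b) :
    HamJoined (Q n) Set.univ a b := by
  induction n with
  | zero => exact absurd (one_le_of_parity_ne hab) (by decide)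
  | succ n ih =>
    obtain ⟨i, v, w, a, b, hvw, rfl, rfl⟩ := exists_face_eq_of_ne (ne_of_apply_ne parity hab)
    rw [Ne, parity_face_eq_iff_of_ne hvw, not_not] at hab
    obtain ⟨c, hac, hcb⟩ :
        ∃ c, HamJoined (Q n) Set.univ a c ∧ HamJoined (Q n) Set.univ c b := by
      rcases n.eq_zero_or_pos with rfl | hn
      · exact ⟨a, .univ_of_subsingleton a a, .univ_of_subsingleton a b⟩
      · obtain ⟨c, hc⟩ := exists_parity_ne hn a
        exact ⟨c, ih hc.symm, ih (hab ▸ hc)⟩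
    exact hac.join_faces i hvw hcb (by simp) (by simp)

theorem exists_forall_hamJoined_compl_singleton (hn : 1 ≤ n) (a : Vertex n) :
    ∃ b, parity b = parity a ∧ ∀ r, parity r ≠ parity a → HamJoined (Q n) {r}ᶜ a b := by
  induction n, hn using Nat.le_induction with
  | base =>
    refine ⟨a, rfl, fun r hr => ?_⟩
    have hcompl : ∀ r a x : Vertex 1, parity r ≠ parity a → (x ≠ r ↔ x = a) := by decide
    rw [show ({r}ᶜ : Set (Vertex 1)) = {a} from Set.ext fun x => hcompl r a x hr]
    exact .singleton a
  | succ n hn ih =>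
    obtain ⟨v, a, rfl⟩ := exists_face_eq 0 a
    obtain ⟨c, hc⟩ := exists_parity_ne hn a
    obtain ⟨d, hd, had⟩ := ih a
    obtain ⟨b, hb, hcb⟩ := ih c
    have hv : v ≠ !v := Bool.self_ne_not v
    refine ⟨face 0 (!v) b, by grind [cases Bool, parity_face], fun r hr => ?_⟩
    obtain ⟨u, r, rfl⟩ := exists_face_eq 0 r
    obtain rfl | rfl : u = v ∨ u = !v := by grind [cases Bool]
    · have hdb : HamJoined (Q n) Set.univ d b := hamJoined_univ (by grind)
      exact (had r (by simpa using hr)).join_faces 0 hv hdb (by simp) (by simp)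
    · have hac : HamJoined (Q n) Set.univ a c := hamJoined_univ hc.symm
      have hrc : parity r ≠ parity c := by grind [cases Bool, parity_face]
      exact hac.join_faces 0 hv (hcb r hrc) (by simp) (by simp)

theorem hamJoined_compl_singleton {r a b : Vertex n} (hab : a ≠ b) (hpab : parity a = parity b)
    (hr : parity r ≠ parity a) : HamJoined (Q n) {r}ᶜ a b := by
  obtain ⟨n, rfl⟩ := Nat.exists_eq_add_of_le' (one_le_of_parity_ne hr)
  obtain ⟨i, v, w, a, b, hvw, rfl, rfl⟩ := exists_face_eq_of_ne hab
  rw [parity_face_eq_iff_of_ne hvw] at hpab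
  have hn : 1 ≤ n := one_le_of_parity_ne hpab
  obtain ⟨u, r, rfl⟩ := exists_face_eq i r
  obtain rfl | rfl : u = v ∨ u = w := by grind [cases Bool]
  · obtain ⟨c, hc, hac⟩ := exists_forall_hamJoined_compl_singleton hn a
    have hcb : HamJoined (Q n) Set.univ c b := hamJoined_univ (hc ▸ hpab)
    exact (hac r (by simpa using hr)).join_faces i hvw hcb (by simp) (by simp [hvw.symm])
  · obtain ⟨c, hc, hbc⟩ := exists_forall_hamJoined_compl_singleton hn b
    have hac : HamJoined (Q n) Set.univ a c := hamJoined_univ (hc ▸ hpab)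
    have hrb : parity r ≠ parity b := by grind [cases Bool, parity_face]
    exact hac.join_faces i hvw (hbc r hrb).symm (by simp [hvw]) (by simp)

theorem hamJoined_compl_pair_of_faces (i : Fin (n + 1)) (hvw : v ≠ w) {r g a : Vertex n}
    (hrg : parity r = parity g) (har : parity a ≠ parity r) :
    HamJoined (Q (n + 1)) {face i v r, face i w g}ᶜ (face i v a) (face i w a) := by
  obtain ⟨b, -, hab⟩ := exists_forall_hamJoined_compl_singleton (one_le_of_parity_ne har) a
  exact (hab r har.symm).join_faces i hvw (hab g (hrg ▸ har.symm)).symm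
    (by simp [hvw]) (by simp [hvw.symm])

theorem exists_hamJoined_compl_pair (hn : 2 ≤ n) {r g : Vertex n} (hrg : parity r ≠ parity g) :
    ∃ a b, parity a = parity r ∧ parity b = parity g ∧ HamJoined (Q n) {r, g}ᶜ a b := by
  obtain ⟨n, rfl⟩ := Nat.exists_eq_add_of_le' (one_le_of_parity_ne hrg)
  obtain ⟨i, v, w, r, g, hvw, rfl, rfl⟩ := exists_face_eq_of_ne (ne_of_apply_ne parity hrg)
  rw [Ne, parity_face_eq_iff_of_ne hvw, not_not] at hrg
  obtain ⟨a, har⟩ := exists_parity_ne (by lia) r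
  exact ⟨face i w a, face i v a, (parity_face_eq_iff_of_ne hvw.symm).2 har,
    (parity_face_eq_iff_of_ne hvw).2 (hrg ▸ har),
    (hamJoined_compl_pair_of_faces i hvw hrg har).symm⟩

theorem exists_forall_hamJoined_compl_pair_of_face (hn : 2 ≤ n) (i : Fin (n + 1)) (hvw : v ≠ w)
    {r g : Vertex n} (hrg : parity r ≠ parity g) :
    ∃ a, parity a = parity r ∧ ∀ b, parity b = parity r →
      HamJoined (Q (n + 1)) {face i v r, face i v g}ᶜ (face i v a) (face i w b) := by
  obtain ⟨a, c, ha, hc, hac⟩ := exists_hamJoined_compl_pair hn hrg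
  refine ⟨a, ha, fun b hb => ?_⟩
  have hcb : HamJoined (Q n) Set.univ c b := hamJoined_univ (by grind)
  exact hac.join_faces i hvw hcb (by simp) (by simp [hvw.symm])

theorem exists_hamJoined_compl_triple_of_faces (hn : 2 ≤ n) (i : Fin (n + 1)) (hvw : v ≠ w)
    {r g₁ g₂ : Vertex n} (hr : parity r ≠ parity g₁) (hg : parity g₁ ≠ parity g₂) :
    ∃ a b, a ≠ b ∧ parity a = parity (face i v r) ∧ parity b = parity (face i v r) ∧
      HamJoined (Q (n + 1)) {face i v r, face i v g₁, face i w g₂}ᶜ a b := by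
  obtain ⟨a, c, ha, hc, hac⟩ := exists_hamJoined_compl_pair hn hr
  obtain ⟨b, hb, hcb⟩ := exists_forall_hamJoined_compl_singleton (by lia) c
  exact ⟨face i v a, face i w b, by simp [hvw], by simpa using ha,
    (parity_face_eq_iff_of_ne hvw.symm).2 (by grind),
    hac.join_faces i hvw (hcb g₂ (by grind)) (by simp [hvw]) (by simp [hvw.symm])⟩

theorem exists_hamJoined_compl_triple (hn : 3 ≤ n) {r g₁ g₂ : Vertex n} (hg : g₁ ≠ g₂)
    (hpg : parity g₁ = parity g₂) (hr : parity r ≠ parity g₁) :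
    ∃ a b, a ≠ b ∧ parity a = parity r ∧ parity b = parity r ∧
      HamJoined (Q n) {r, g₁, g₂}ᶜ a b := by
  obtain ⟨n, rfl⟩ := Nat.exists_eq_add_of_le' (one_le_of_parity_ne hr)
  obtain ⟨i, v, w, g₁, g₂, hvw, rfl, rfl⟩ := exists_face_eq_of_ne hg
  obtain ⟨u, r, rfl⟩ := exists_face_eq i r
  have hpg' := (parity_face_eq_iff_of_ne hvw).1 hpg
  obtain rfl | rfl : u = v ∨ u = w := by grind [cases Bool]
  · exact exists_hamJoined_compl_triple_of_faces (by lia) i hvw (by simpa using hr) hpg'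
  · rw [hpg] at hr
    rw [Set.pair_comm (face i v g₁)]
    exact exists_hamJoined_compl_triple_of_faces (by lia) i hvw.symm (by simpa using hr) hpg'.symm

end HamiltonianPaths

section HamiltonianCycles

variable {n : ℕ} {v w : Bool}

theorem qminus_isHamiltonian_of_three_one (hn : 3 ≤ n) (i : Fin (n + 1)) (hvw : v ≠ w)
    {r₁ r₂ g₁ g₂ : Vertex n} (hg : g₁ ≠ g₂) (hpg : parity g₁ = parity g₂)
    (hr₁ : parity r₁ ≠ parity g₁) (hr₂ : parity r₂ = parity g₁) :
    (Qminus (n + 1) {face i v r₁, face i w r₂, face i v g₁, face i v g₂}).IsHamiltonian := by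
  obtain ⟨a, b, hab, ha, hb, h⟩ := exists_hamJoined_compl_triple hn hg hpg hr₁
  have h' : HamJoined (Q n) {r₂}ᶜ a b := hamJoined_compl_singleton hab (by grind) (by grind)
  exact h.qminus_isHamiltonian hab h' i hvw (by simp [hvw]) (by simp [hvw.symm])

theorem qminus_isHamiltonian_of_two_two (hn : 2 ≤ n) (i : Fin (n + 2)) (hvw : v ≠ w)
    {r₁ r₂ g₁ g₂ : Vertex (n + 1)} (h₁ : parity r₁ ≠ parity g₁) (h₂ : parity r₂ ≠ parity g₂)
    (hr : parity r₁ ≠ parity r₂) {j : Fin (n + 1)} (hrj : r₁ j ≠ r₂ j) (hgj : g₁ j ≠ g₂ j) :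
    (Qminus (n + 2) {face i v r₁, face i w r₂, face i v g₁, face i w g₂}).IsHamiltonian := by
  suffices ∃ a b, a ≠ b ∧ HamJoined (Q (n + 1)) {r₁, g₁}ᶜ a b ∧
      HamJoined (Q (n + 1)) {r₂, g₂}ᶜ a b by
    obtain ⟨a, b, hab, h, h'⟩ := this
    exact h.qminus_isHamiltonian hab h' i hvw (by simp [hvw]) (by simp [hvw.symm])
  obtain ⟨s, r₁, rfl⟩ := exists_face_eq j r₁
  obtain ⟨t, r₂, rfl⟩ := exists_face_eq j r₂
  obtain ⟨s', g₁, rfl⟩ := exists_face_eq j g₁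
  obtain ⟨t', g₂, rfl⟩ := exists_face_eq j g₂
  rw [face_apply_self, face_apply_self] at hrj hgj
  obtain ⟨rfl, rfl⟩ | ⟨rfl, rfl⟩ : s' = s ∧ t' = t ∨ s' = t ∧ t' = s := by grind [cases Bool]
  · rw [Ne, parity_face_eq_iff_of_ne hrj, not_not] at hr
    rw [Ne, parity_face_eq_iff] at h₁ h₂
    obtain ⟨a, ha, h⟩ := exists_forall_hamJoined_compl_pair_of_face hn j hrj h₁
    obtain ⟨b, hb, h'⟩ := exists_forall_hamJoined_compl_pair_of_face hn j hrj.symm h₂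
    exact ⟨face j s' a, face j t' b, by simp [hrj], h b (hb.trans hr.symm),
      (h' a (ha.trans hr)).symm⟩
  · rw [Ne, parity_face_eq_iff_of_ne hrj, not_not] at hr
    rw [Ne, parity_face_eq_iff_of_ne hrj, not_not] at h₁
    rw [Ne, parity_face_eq_iff_of_ne hrj.symm, not_not] at h₂
    obtain ⟨a, ha⟩ := exists_parity_ne (by lia) r₁
    refine ⟨face j t' a, face j s' a, by simp [hrj],
      hamJoined_compl_pair_of_faces j hrj h₁ ha, ?_⟩
    rw [Set.pair_comm]
    exact hamJoined_compl_pair_of_faces j hrj h₂.symm (by grind)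

theorem qminus_isHamiltonian_of_apply_ne_of_apply_eq (hn : 4 ≤ n) {r₁ r₂ g₁ g₂ : Vertex n}
    (hg : g₁ ≠ g₂) (hpr : parity r₁ = parity r₂) (hpg : parity g₁ = parity g₂)
    (hrg : parity r₁ ≠ parity g₁) {i : Fin n} (hri : r₁ i ≠ r₂ i) (hgi : g₁ i = g₂ i) :
    (Qminus n {r₁, r₂, g₁, g₂}).IsHamiltonian := by
  obtain ⟨n, rfl⟩ := Nat.exists_eq_add_of_le' (show 1 ≤ n by lia)
  obtain ⟨v, r₁, rfl⟩ := exists_face_eq i r₁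
  obtain ⟨w, r₂, rfl⟩ := exists_face_eq i r₂
  obtain ⟨u, g₁, rfl⟩ := exists_face_eq i g₁
  obtain ⟨u', g₂, rfl⟩ := exists_face_eq i g₂
  rw [face_apply_self, face_apply_self] at hri hgi
  obtain rfl := hgi
  rw [parity_face_eq_iff] at hpg
  have hg' : g₁ ≠ g₂ := ne_of_apply_ne _ hg
  obtain rfl | rfl : u = v ∨ u = w := by grind [cases Bool]
  · exact qminus_isHamiltonian_of_three_one (by lia) i hri hg' hpg
      (by grind [cases Bool, parity_face]) (by grind [cases Bool, parity_face])
  · rw [Finset.insert_comm]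
    exact qminus_isHamiltonian_of_three_one (by lia) i hri.symm hg' hpg
      (by grind [cases Bool, parity_face]) (by grind [cases Bool, parity_face])

theorem qminus_isHamiltonian_of_forall_apply_ne (hn : 4 ≤ n) {r₁ r₂ g₁ g₂ : Vertex n}
    (hr : r₁ ≠ r₂) (hpr : parity r₁ = parity r₂) (hpg : parity g₁ = parity g₂)
    (hrg : parity r₁ ≠ parity g₁) (hsep : ∀ i, r₁ i ≠ r₂ i → g₁ i ≠ g₂ i) :
    (Qminus n {r₁, r₂, g₁, g₂}).IsHamiltonian := by
  obtain ⟨n, rfl⟩ := Nat.exists_eq_add_of_le' (show 2 ≤ n by lia)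
  obtain ⟨i, v, w, r₁, r₂, hvw, rfl, rfl⟩ := exists_face_eq_of_ne hr
  obtain ⟨u, g₁, rfl⟩ := exists_face_eq i g₁
  obtain ⟨u', g₂, rfl⟩ := exists_face_eq i g₂
  have hgi : u ≠ u' := by simpa [hvw] using hsep i
  have hpr' := (parity_face_eq_iff_of_ne hvw).1 hpr
  obtain ⟨j, hrj⟩ := Function.ne_iff.1 (ne_of_apply_ne parity hpr')
  have hgj : g₁ j ≠ g₂ j := by simpa [hrj] using hsep (i.succAbove j)
  obtain ⟨rfl, rfl⟩ | ⟨rfl, rfl⟩ : u = v ∧ u' = w ∨ u = w ∧ u' = v := by grind [cases Bool]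
  · exact qminus_isHamiltonian_of_two_two (by lia) i hvw (by grind [cases Bool, parity_face])
      (by grind [cases Bool, parity_face]) hpr' hrj hgj
  · rw [Finset.pair_comm (face i u g₁)]
    exact qminus_isHamiltonian_of_two_two (by lia) i hvw (by grind [cases Bool, parity_face])
      (by grind [cases Bool, parity_face]) hpr' hrj hgj.symm

theorem exists_eq_of_isNeutral_of_mass_eq_four {F : Fault n} (hF : IsNeutral F)
    (hM : mass F = 4) :
    ∃ r₁ r₂ g₁ g₂, r₁ ≠ r₂ ∧ g₁ ≠ g₂ ∧ parity r₁ = parity r₂ ∧ parity g₁ = parity g₂ ∧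
      parity r₁ ≠ parity g₁ ∧ F = {r₁, r₂, g₁, g₂} := by
  have hcard := Finset.card_filter_add_card_filter_not (s := F) IsEven
  rw [IsNeutral, charge, Int.natAbs_eq_zero, sub_eq_zero, Nat.cast_inj] at hF
  rw [mass] at hM
  obtain ⟨r₁, r₂, hr, hE⟩ := Finset.card_eq_two.1
    (show (F.filter fun x => IsEven x).card = 2 by lia)
  obtain ⟨g₁, g₂, hg, hO⟩ := Finset.card_eq_two.1
    (show (F.filter fun x => ¬ IsEven x).card = 2 by lia)
  have hEven : ∀ x ∈ ({r₁, r₂} : Finset (Vertex n)), parity x = false := by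
    intro x hx
    rw [← hE, Finset.mem_filter] at hx
    simpa [parity] using hx.2
  have hOdd : ∀ x ∈ ({g₁, g₂} : Finset (Vertex n)), parity x = true := by
    intro x hx
    rw [← hO, Finset.mem_filter] at hx
    simpa [parity] using hx.2
  refine ⟨r₁, r₂, g₁, g₂, hr, hg, ?_, ?_, ?_, ?_⟩
  · simp [hEven]
  · simp [hOdd]
  · simp [hEven, hOdd]
  · rw [← Finset.filter_union_filter_not_eq IsEven F, hE, hO, Finset.insert_union,
      Finset.singleton_union]

theorem hamiltonianForNeutral_four (hn : 4 ≤ n) : HamiltonianForNeutral 4 n := by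
  intro F hF hM
  obtain ⟨r₁, r₂, g₁, g₂, hr, hg, hpr, hpg, hrg, rfl⟩ :=
    exists_eq_of_isNeutral_of_mass_eq_four hF hM
  by_cases hsep : ∃ i, r₁ i ≠ r₂ i ∧ g₁ i = g₂ i
  · obtain ⟨i, hri, hgi⟩ := hsep
    exact qminus_isHamiltonian_of_apply_ne_of_apply_eq hn hg hpr hpg hrg hri hgi
  · push Not at hsep
    exact qminus_isHamiltonian_of_forall_apply_ne hn hr hpr hpg hrg hsep

end HamiltonianCycles

section CubeFault

/-- The neutral fault of `Q 3` that leaves only the two disjoint edges `000`–`001` and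
`110`–`111`. -/
def cubeFault : Fault 3 :=
  {![false, true, false], ![true, false, false], ![true, false, true], ![false, true, true]}

theorem isNeutral_cubeFault : IsNeutral cubeFault := by
  unfold IsNeutral
  decide

theorem mass_cubeFault : mass cubeFault = 4 := by
  decide

theorem apply_zero_eq_of_reachable_qminus_cubeFault {x y : {x : Vertex 3 // x ∉ cubeFault}}
    (h : (Qminus 3 cubeFault).Reachable x y) : x.1 0 = y.1 0 := by
  have hadj : ∀ x y : Vertex 3, x ∉ cubeFault → y ∉ cubeFault → hammingDist x y = 1 →
      x 0 = y 0 := by decide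
  obtain ⟨p⟩ := h
  induction p with
  | nil => rfl
  | @cons x y _ hxy _ ih => exact (hadj x y x.2 y.2 hxy).trans ih

theorem not_isHamiltonian_qminus_cubeFault : ¬ (Qminus 3 cubeFault).IsHamiltonian := by
  intro h
  have hreach : (Qminus 3 cubeFault).Reachable ⟨fun _ => false, by decide⟩
      ⟨fun _ => true, by decide⟩ := h.connected.preconnected _ _
  exact absurd (apply_zero_eq_of_reachable_qminus_cubeFault hreach) (by decide)

end CubeFault

end FaultyCube

theorem mainTheorem1 :
    (∀ (n : ℕ), 4 ≤ n → ∀ F : FaultyCube.Fault n,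
      FaultyCube.IsNeutral F → FaultyCube.mass F = 4 → (FaultyCube.Qminus n F).IsHamiltonian) ∧
    (∃ F : FaultyCube.Fault 3,
      FaultyCube.IsNeutral F ∧ FaultyCube.mass F = 4 ∧ ¬ (FaultyCube.Qminus 3 F).IsHamiltonian) ∧
    IsLeast (FaultyCube.A 4) 4 := by
  refine ⟨fun n hn => FaultyCube.hamiltonianForNeutral_four hn,
    ⟨FaultyCube.cubeFault, FaultyCube.isNeutral_cubeFault, FaultyCube.mass_cubeFault,
      FaultyCube.not_isHamiltonian_qminus_cubeFault⟩,
    ⟨by decide, fun n hn => FaultyCube.hamiltonianForNeutral_four hn⟩, fun m hm => ?_⟩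
  by_contra! hm4
  exact FaultyCube.not_isHamiltonian_qminus_cubeFault <|
    hm.2 3 (by lia) _ FaultyCube.isNeutral_cubeFault FaultyCube.mass_cubeFault
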